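/- **Outer bounds without cooperation.** Consider the two-user doubly-dirty Gaussian multiple access channel $$y[n]=x_1[n]+x_2[n]+s_1[n]+s_2[n]+z[n],\qquad n=1,\dots,N,$$ where $s_1^N,s_2^N,z^N$ are independent i.i.d. Gaussian sequences with $s_i[n]\sim\mathcal N(0,Q_i)$, $z[n]\sim\mathcal N(0,N_o)$, $Q_1,Q_2\ge 0$, $N_o>0$. The interference $s_i^N$ is known non-causally to transmitter $i$ only and is unknown to the receiver, and the transmitters do not cooperate. For powers $P_1,P_2\ge 0$ put $\mathsf{SNR}_i=P_i/N_o$, $\mathsf{INR}_2=Q_2/N_o$ and $\mathcal C(x)=\tfrac12\log_2(1+x)$. A code of block length $N$ with $M_1$ and $M_2$ messages consists of measurable encoders $x_i^N=f_i(w_i,s_i^N)$, $w_i\in\{1,\dots,M_i\}$, $i=1,2$, and a measurable decoder $(\hat w_1,\hat w_2)=g(y^N)$. The messages $w_1,w_2$ are uniform and independent of each other and of $(s_1^N,s_2^N,z^N)$. The code satisfies the power constraints if $\frac1N\sum_{n=1}^N\mathbb E\big[x_i[n]^2\big]\le P_i$ for $i=1,2$. A pair $(R_1,R_2)$ is achievable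 if for every $\varepsilon>0$ and all sufficiently large $N$ there is a code of block length $N$ that satisfies the power constraints, has $M_i\ge 2^{N(R_i-\varepsilon)}$ for $i=1,2$, and has $\Pr[(\hat w_1,\hat w_2)\ne(w_1,w_2)]\le\varepsilon$. If a nonnegative pair $(R_1,R_2)$ is achievable, then $$R_1+R_2\le\mathcal C(\mathsf{SNR}_1+\mathsf{SNR}_2),$$ $$R_1+R_2\le\mathcal C\!\left(\frac{1+\mathsf{SNR}_1+\mathsf{SNR}_2}{\mathsf{INR}_2}\right)+\mathcal C(\mathsf{SNR}_2)\quad\text{if } Q_2>0,$$ $$R_2\le\mathcal C(\mathsf{SNR}_2).$$ -/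

import Mathlib

open MeasureTheory ProbabilityTheory Filter
open scoped NNReal ENNReal

noncomputable section

/-- The function `𝒞(x) = (1/2) log₂ (1 + x)`. -/
def awgnCap (x : ℝ) : ℝ := (1 / 2) * Real.logb 2 (1 + x)

/-- Parameters of the two-user doubly-dirty Gaussian multiple access channel
`y = x₁ + x₂ + s₁ + s₂ + z`, where `sᵢ ~ N(0, Qᵢ)` is known non-causally to transmitter `i` only,
`z ~ N(0, No)`, and transmitter `i` has average power at most `Pᵢ`. -/
structure DirtyMAC where
  P₁ : ℝ≥0
  P₂ : ℝ≥0
  Q₁ : ℝ≥0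
  Q₂ : ℝ≥0
  No : ℝ≥0
  No_pos : 0 < No

namespace DirtyMAC

def SNR₁ (ch : DirtyMAC) : ℝ := (ch.P₁ : ℝ) / (ch.No : ℝ)

def SNR₂ (ch : DirtyMAC) : ℝ := (ch.P₂ : ℝ) / (ch.No : ℝ)

def INR₂ (ch : DirtyMAC) : ℝ := (ch.Q₂ : ℝ) / (ch.No : ℝ)

/-- Law of a block of `N` independent centred Gaussian variables of variance `v`. -/
def whiteGaussian (N : ℕ) (v : ℝ≥0) : Measure (Fin N → ℝ) :=
  Measure.pi fun _ => gaussianReal 0 v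

/-- Joint law of the independent blocks `(s₁, s₂, z)`. -/
def blockLaw (ch : DirtyMAC) (N : ℕ) :
    Measure ((Fin N → ℝ) × (Fin N → ℝ) × (Fin N → ℝ)) :=
  (whiteGaussian N ch.Q₁).prod ((whiteGaussian N ch.Q₂).prod (whiteGaussian N ch.No))

/-- A block code of length `N` without transmitter cooperation, with `M₁` and `M₂` messages:
the block sent by transmitter `i` depends on its own message and on the whole block `sᵢ`
(non-causal knowledge), and the receiver decodes both messages from the received block. -/
structure Code (N M₁ M₂ : ℕ) where
  enc₁ : Fin M₁ → (Fin N → ℝ) → (Fin N → ℝ)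
  enc₂ : Fin M₂ → (Fin N → ℝ) → (Fin N → ℝ)
  dec : (Fin N → ℝ) → Fin M₁ × Fin M₂
  measurable_enc₁ : ∀ w, Measurable (enc₁ w)
  measurable_enc₂ : ∀ w, Measurable (enc₂ w)
  measurable_dec : Measurable dec

/-- Power of an encoder whose side information is white Gaussian of variance `v`: the expectation
of the mean square of the sent symbols over the block, over a uniformly distributed message and
over the side information. -/
def encPower {N M : ℕ} (v : ℝ≥0) (enc : Fin M → (Fin N → ℝ) → (Fin N → ℝ)) : ℝ≥0∞ :=
  (∑ w, ∑ n, ∫⁻ s, ENNReal.ofReal (enc w s n ^ 2) ∂(whiteGaussian N v)) / ((M : ℝ≥0∞) * N)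

/-- The received block. -/
def output {N M₁ M₂ : ℕ} (c : Code N M₁ M₂) (w₁ : Fin M₁) (w₂ : Fin M₂)
    (s₁ s₂ z : Fin N → ℝ) : Fin N → ℝ :=
  c.enc₁ w₁ s₁ + c.enc₂ w₂ s₂ + s₁ + s₂ + z

/-- Probability of decoding error, for independent uniformly distributed messages. -/
def errorProb (ch : DirtyMAC) {N M₁ M₂ : ℕ} (c : Code N M₁ M₂) : ℝ≥0∞ :=
  (∑ w₁, ∑ w₂, ch.blockLaw N {p | c.dec (output c w₁ w₂ p.1 p.2.1 p.2.2) ≠ (w₁, w₂)}) /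
    ((M₁ : ℝ≥0∞) * M₂)

/-- `(R₁, R₂)`, in bits per channel use, is achievable without cooperation: for every `ε > 0` and
all sufficiently large block lengths `N` there is a code that obeys both power constraints, has at
least `2 ^ (N (Rᵢ - ε))` messages for user `i`, and has error probability at most `ε`. -/
def Achievable (ch : DirtyMAC) (R₁ R₂ : ℝ) : Prop :=
  ∀ ε : ℝ, 0 < ε → ∀ᶠ N : ℕ in atTop, ∃ (M₁ M₂ : ℕ) (c : Code N M₁ M₂),
    (2 : ℝ) ^ ((N : ℝ) * (R₁ - ε)) ≤ (M₁ : ℝ) ∧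
    (2 : ℝ) ^ ((N : ℝ) * (R₂ - ε)) ≤ (M₂ : ℝ) ∧
    encPower ch.Q₁ c.enc₁ ≤ (ch.P₁ : ℝ≥0∞) ∧
    encPower ch.Q₂ c.enc₂ ≤ (ch.P₂ : ℝ≥0∞) ∧
    ch.errorProb c ≤ ENNReal.ofReal ε

end DirtyMAC

end

/-! The proof is a weak converse by change of measure. With the messages included in the probability
space, the true law is compared with a reference law of density `exp (-L)` under which the output
carries no information about the messages to be decoded. There, guessing one of `M` messages
succeeds with probability at most `1 / M`, so `prob_mul_log_le` gives `(1 - ε) log M ≤ E[L] + log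
2`. The relative entropy `E[L]` replaces mutual information. For Gaussian references it involves
only second moments (`integral_llr_le`), which the power constraints control.

For the first bound, the reference output given `s₁, s₂` is Gaussian with centre `m + s₁ + s₂`, `m`
being the mean of `x₁`, and variance `P₁ + P₂ + No`. For the bound on `R₂` the centre is `x₁ + s₁ +
s₂` and the variance `P₂ + No`.

For the second bound the output is centred at `m + s₁` with variance `σ`, and `s₂` is redrawn around
its estimate `a (y - x₁ - s₁)` with variance `D`. Then `E[L]` is at most `N/2 log (σ / No) + N/2 log
(D / Q₂)`. Since `x₂` may be correlated with `s₂`, `integral_dirtyDensity_le` chooses `a, σ, D`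
according to the sign of the correlation. -/

noncomputable section

namespace DirtyMAC

/-! ### Fano's inequality by change of measure. -/

/-- The change-of-measure bound behind Fano's inequality: if `exp (-L)` is a (sub)density under
which the event `A` has mass at most `1 / M`, then `P(A) log M ≤ E[L] + log 2`. -/
theorem prob_mul_log_le {Ω : Type*} [MeasurableSpace Ω] (P : Measure Ω) [IsProbabilityMeasure P]
    {A : Set Ω} (hA : MeasurableSet A) {L : Ω → ℝ} (hLm : Measurable L) (hL : Integrable L P)
    {M : ℝ} (hM : 1 ≤ M) (h1 : ∫⁻ x, ENNReal.ofReal (Real.exp (-L x)) ∂P ≤ 1)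
    (h2 : ∫⁻ x in A, ENNReal.ofReal (Real.exp (-L x)) ∂P ≤ ENNReal.ofReal M⁻¹) :
    P.real A * Real.log M ≤ ∫ x, L x ∂P + Real.log 2 := by
  have hM0 : 0 < M := by linarith
  have hem : Measurable fun x => Real.exp (-L x) := by fun_prop
  have hei : Integrable (fun x => Real.exp (-L x)) P := by
    refine ⟨hem.aestronglyMeasurable, ?_⟩
    rw [hasFiniteIntegral_iff_ofReal (ae_of_all _ fun x => (Real.exp_pos _).le)]
    exact h1.trans_lt ENNReal.one_lt_top
  have e1 : ∫ x, Real.exp (-L x) ∂P ≤ 1 := by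
    rw [integral_eq_lintegral_of_nonneg_ae (ae_of_all _ fun x => (Real.exp_pos _).le)
      hem.aestronglyMeasurable]
    exact ENNReal.toReal_le_of_le_ofReal zero_le_one (by simpa using h1)
  have e2 : ∫ x in A, Real.exp (-L x) ∂P ≤ M⁻¹ := by
    rw [integral_eq_lintegral_of_nonneg_ae (ae_of_all _ fun x => (Real.exp_pos _).le)
      hem.aestronglyMeasurable]
    exact ENNReal.toReal_le_of_le_ofReal (by positivity) h2
  -- This is `log u ≤ u - 1` at `u = t exp (-L) / 2`, with `t = M` on `A` and `t = 1` off it. After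
  -- integration the two masses on the right are each at most one, so their average cancels the `-1`
  -- and `log 2` remains.
  have hpt : ∀ x, A.indicator (fun _ => Real.log M) x - L x ≤
      Real.log 2 - 1 + (M * A.indicator (fun x => Real.exp (-L x)) x + Real.exp (-L x)) / 2 := by
    intro x
    have key : ∀ t : ℝ, 0 < t →
        Real.log t - L x ≤ Real.log 2 - 1 + t * Real.exp (-L x) / 2 := by
      intro t ht
      have := Real.log_le_sub_one_of_pos (x := t * Real.exp (-L x) / 2) (by positivity)
      rw [Real.log_div (by positivity) (by norm_num), Real.log_mul ht.ne' (Real.exp_pos _).ne',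
        Real.log_exp] at this
      linarith
    by_cases hx : x ∈ A
    · simp only [Set.indicator_of_mem hx]
      have := key M hM0
      have := Real.exp_pos (-L x)
      linarith
    · simp only [Set.indicator_of_notMem hx]
      have := key 1 one_pos
      simp only [Real.log_one, one_mul] at this
      linarith
  have i1 : Integrable (A.indicator fun _ => Real.log M) P := (integrable_const _).indicator hA
  have i2 : Integrable (A.indicator fun x => Real.exp (-L x)) P := hei.indicator hA
  have := integral_mono (i1.sub hL)
    ((integrable_const (Real.log 2 - 1)).add (((i2.const_mul M).add hei).div_const 2)) hpt
  simp only [Pi.sub_apply, Pi.add_apply] at this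
  rw [integral_sub i1 hL, integral_indicator_const _ hA] at this
  have i3 : Integrable (fun x => (M * A.indicator (fun x => Real.exp (-L x)) x
      + Real.exp (-L x)) / 2) P := ((i2.const_mul M).add hei).div_const 2
  rw [integral_add (integrable_const _) i3, integral_div, integral_add (i2.const_mul M) hei, integral_const_mul,
    integral_indicator hA] at this
  simp only [integral_const, probReal_univ, smul_eq_mul, one_mul] at this
  have h3 : M * ∫ x in A, Real.exp (-L x) ∂P ≤ 1 := by
    calc _ ≤ M * M⁻¹ := by gcongr
      _ = 1 := mul_inv_cancel₀ hM0.ne'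
  linarith

/-! ### White Gaussian blocks: densities, likelihood ratios, moments. -/

/-- The density of `whiteGaussian`. -/
def whitePDF (N : ℕ) (v : ℝ≥0) (x : Fin N → ℝ) : ℝ := ∏ n, gaussianPDFReal 0 v (x n)

theorem measurable_whitePDF (N : ℕ) (v : ℝ≥0) : Measurable (whitePDF N v) := by
  unfold whitePDF
  exact Finset.measurable_prod _ fun n _ => (measurable_gaussianPDFReal 0 v).comp (measurable_pi_apply n)

theorem whitePDF_nonneg (N : ℕ) (v : ℝ≥0) (x : Fin N → ℝ) : 0 ≤ whitePDF N v x :=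
  Finset.prod_nonneg fun _ _ => gaussianPDFReal_nonneg _ _ _

theorem whiteGaussian_eq_withDensity (N : ℕ) {v : ℝ≥0} (hv : v ≠ 0) :
    whiteGaussian N v = volume.withDensity fun x => ENNReal.ofReal (whitePDF N v x) := by
  refine Measure.pi_eq fun s hs => ?_
  have hbox : MeasurableSet (Set.univ.pi s) := MeasurableSet.univ_pi hs
  have hI : ∀ n, Integrable ((s n).indicator (gaussianPDFReal 0 v)) volume := fun n =>
    (integrable_gaussianPDFReal 0 v).indicator (hs n)
  have h0 : ∀ n x, 0 ≤ (s n).indicator (gaussianPDFReal 0 v) x := fun n x =>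
    Set.indicator_nonneg (fun y _ => gaussianPDFReal_nonneg 0 v y) x
  have hprod : ∀ x : Fin N → ℝ, (Set.univ.pi s).indicator (fun x => ENNReal.ofReal (whitePDF N v x)) x
      = ENNReal.ofReal (∏ n, (s n).indicator (gaussianPDFReal 0 v) (x n)) := by
    intro x
    by_cases hx : x ∈ Set.univ.pi s
    · rw [Set.indicator_of_mem hx, whitePDF]
      congr 1
      exact Finset.prod_congr rfl fun n _ => (Set.indicator_of_mem (hx n trivial) _).symm
    · rw [Set.indicator_of_notMem hx]
      simp only [Set.mem_pi, Set.mem_univ, forall_const, not_forall] at hx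
      obtain ⟨n, hn⟩ := hx
      rw [Finset.prod_eq_zero (Finset.mem_univ n) (Set.indicator_of_notMem hn _), ENNReal.ofReal_zero]
  rw [withDensity_apply _ hbox, ← lintegral_indicator hbox]
  simp_rw [hprod]
  have hIp : Integrable (fun x : Fin N → ℝ => ∏ n, (s n).indicator (gaussianPDFReal 0 v) (x n))
      volume := Integrable.fintype_prod hI
  rw [← ofReal_integral_eq_lintegral_ofReal hIp
    (ae_of_all _ fun x => Finset.prod_nonneg fun n _ => h0 n _),
    integral_fintype_prod_volume_eq_prod,
    ENNReal.ofReal_prod_of_nonneg fun n _ => integral_nonneg (h0 n)]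
  refine Finset.prod_congr rfl fun n _ => ?_
  rw [integral_indicator (hs n), gaussianReal_apply_eq_integral _ hv]

/-- The logarithm of the density ratio of `z ∼ N(0, v I)` at `z` and `N(0, σ I)` at `z + t`. -/
def llr {N : ℕ} (v σ : ℝ) (z t : Fin N → ℝ) : ℝ :=
  ∑ n, (1 / 2 * Real.log (σ / v) + ((z n + t n) ^ 2 / (2 * σ) - z n ^ 2 / (2 * v)))

theorem measurable_llr {N : ℕ} (v σ : ℝ) {α : Type*} [MeasurableSpace α] {z t : α → Fin N → ℝ}
    (hz : Measurable z) (ht : Measurable t) : Measurable fun a => llr v σ (z a) (t a) := by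
  unfold llr
  fun_prop

theorem exp_neg_llr_mul {N : ℕ} {v σ : ℝ≥0} (hv : 0 < v) (hσ : 0 < σ) (z t : Fin N → ℝ) :
    whitePDF N v z * Real.exp (-llr v σ z t) = whitePDF N σ (z + t) := by
  rw [llr, ← Finset.sum_neg_distrib, Real.exp_sum, whitePDF, whitePDF, ← Finset.prod_mul_distrib]
  refine Finset.prod_congr rfl fun n _ => ?_
  have hv' : (0 : ℝ) < v := hv
  have hσ' : (0 : ℝ) < σ := hσ
  have hpi := Real.pi_pos
  have hsv : 0 < √(2 * Real.pi * v) := Real.sqrt_pos.2 (by positivity)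
  have hsσ : 0 < √(2 * Real.pi * σ) := Real.sqrt_pos.2 (by positivity)
  have hlog : 1 / 2 * Real.log ((σ : ℝ) / v)
      = Real.log (√(2 * Real.pi * σ)) - Real.log (√(2 * Real.pi * v)) := by
    rw [Real.log_sqrt (by positivity), Real.log_sqrt (by positivity),
      Real.log_div hσ'.ne' hv'.ne', Real.log_mul (by positivity) hσ'.ne',
      Real.log_mul (by positivity) hv'.ne']
    ring
  rw [hlog, gaussianPDFReal, gaussianPDFReal,
    ← Real.exp_log (inv_pos.2 hsv), ← Real.exp_log (inv_pos.2 hsσ), Real.log_inv, Real.log_inv,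
    ← Real.exp_add, ← Real.exp_add, ← Real.exp_add, Pi.add_apply]
  congr 1
  ring

/-- The tilt by `exp (-llr)` gives `z + t` the law `N(0, σ I)`: it replaces the density at `z` by
the new density at `z + t`, and Lebesgue measure is translation invariant. -/
theorem lintegral_exp_neg_llr {N : ℕ} {v σ : ℝ≥0} (hv : 0 < v) (hσ : 0 < σ) (t : Fin N → ℝ)
    {f : (Fin N → ℝ) → ℝ≥0∞} (hf : Measurable f) :
    ∫⁻ z, ENNReal.ofReal (Real.exp (-llr v σ z t)) * f (z + t) ∂(whiteGaussian N v)
      = ∫⁻ u, f u ∂(whiteGaussian N σ) := by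
  have hm : Measurable fun z : Fin N → ℝ => ENNReal.ofReal (Real.exp (-llr v σ z t)) :=
    (Real.measurable_exp.comp (measurable_llr _ _ measurable_id measurable_const).neg).ennreal_ofReal
  have hmf : Measurable fun z : Fin N → ℝ =>
      ENNReal.ofReal (Real.exp (-llr v σ z t)) * f (z + t) :=
    hm.mul (hf.comp (measurable_id.add_const t))
  rw [whiteGaussian_eq_withDensity N hv.ne', whiteGaussian_eq_withDensity N hσ.ne',
    lintegral_withDensity_eq_lintegral_mul _ (measurable_whitePDF N v).ennreal_ofReal hmf,
    lintegral_withDensity_eq_lintegral_mul _ (measurable_whitePDF N σ).ennreal_ofReal hf,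
    ← lintegral_add_right_eq_self
      ((fun x => ENNReal.ofReal (whitePDF N σ x)) * f) t]
  refine lintegral_congr fun z => ?_
  simp only [Pi.mul_apply]
  rw [← mul_assoc, ← ENNReal.ofReal_mul (whitePDF_nonneg _ _ _), exp_neg_llr_mul hv hσ]

instance (N : ℕ) (v : ℝ≥0) : IsProbabilityMeasure (whiteGaussian N v) := by
  unfold whiteGaussian; infer_instance

theorem memLp_whiteGaussian_apply (N : ℕ) (v : ℝ≥0) (n : Fin N) :
    MemLp (fun s : Fin N → ℝ => s n) 2 (whiteGaussian N v) :=
  (memLp_id_gaussianReal' 2 (by simp)).comp_measurePreserving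
    (measurePreserving_eval (fun _ : Fin N => gaussianReal 0 v) n)

theorem integral_whiteGaussian_apply (N : ℕ) (v : ℝ≥0) (n : Fin N) :
    ∫ s, s n ∂(whiteGaussian N v) = 0 := by
  have := integral_comp_eval (μ := fun _ : Fin N => gaussianReal 0 v) (i := n) (f := fun x => x)
    aestronglyMeasurable_id
  rw [whiteGaussian, this, integral_id_gaussianReal]

theorem integral_whiteGaussian_apply_sq (N : ℕ) (v : ℝ≥0) (n : Fin N) :
    ∫ s, s n ^ 2 ∂(whiteGaussian N v) = v := by
  have := integral_comp_eval (μ := fun _ : Fin N => gaussianReal 0 v) (i := n)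
    (f := fun x => x ^ 2) (by fun_prop)
  rw [whiteGaussian, this]
  have h := variance_id_gaussianReal (μ := 0) (v := v)
  rw [variance_eq_integral aemeasurable_id] at h
  simpa using h

/-! ### Joint law of messages, interferences and noise. -/

/-- Law of a uniform message together with an independent white Gaussian block. -/
def userLaw (N M : ℕ) (v : ℝ≥0) : Measure (Fin M × (Fin N → ℝ)) :=
  ((M : ℝ≥0∞)⁻¹ • Measure.count).prod (whiteGaussian N v)

/-- Joint law of `((w₁, s₁), (w₂, s₂), z)`. -/
def jointLaw (ch : DirtyMAC) (N M₁ M₂ : ℕ) :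
    Measure ((Fin M₁ × (Fin N → ℝ)) × (Fin M₂ × (Fin N → ℝ)) × (Fin N → ℝ)) :=
  (userLaw N M₁ ch.Q₁).prod ((userLaw N M₂ ch.Q₂).prod (whiteGaussian N ch.No))

theorem isProbabilityMeasure_uniform {M : ℕ} (hM : M ≠ 0) :
    IsProbabilityMeasure ((M : ℝ≥0∞)⁻¹ • (Measure.count : Measure (Fin M))) := by
  constructor
  rw [Measure.smul_apply, Measure.count_univ]
  simp [ENNReal.inv_mul_cancel, hM]

theorem isProbabilityMeasure_userLaw (N : ℕ) {M : ℕ} (hM : M ≠ 0) (v : ℝ≥0) :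
    IsProbabilityMeasure (userLaw N M v) := by
  have := isProbabilityMeasure_uniform hM
  unfold userLaw; infer_instance

theorem isProbabilityMeasure_jointLaw (ch : DirtyMAC) (N : ℕ) {M₁ M₂ : ℕ} (h₁ : M₁ ≠ 0)
    (h₂ : M₂ ≠ 0) : IsProbabilityMeasure (jointLaw ch N M₁ M₂) := by
  have := isProbabilityMeasure_userLaw N h₁ ch.Q₁
  have := isProbabilityMeasure_userLaw N h₂ ch.Q₂
  unfold jointLaw; infer_instance

theorem lintegral_userLaw {N M : ℕ} (hM : M ≠ 0) (v : ℝ≥0)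
    {F : Fin M × (Fin N → ℝ) → ℝ≥0∞} (hF : Measurable F) :
    ∫⁻ p, F p ∂(userLaw N M v) = (M : ℝ≥0∞)⁻¹ * ∑ w, ∫⁻ s, F (w, s) ∂(whiteGaussian N v) := by
  have := isProbabilityMeasure_uniform hM
  rw [userLaw, lintegral_prod _ hF.aemeasurable, lintegral_smul_measure, lintegral_count,
    tsum_fintype, smul_eq_mul]

theorem lintegral_jointLaw (ch : DirtyMAC) {N M₁ M₂ : ℕ} (h₁ : M₁ ≠ 0) (h₂ : M₂ ≠ 0)
    {F : (Fin M₁ × (Fin N → ℝ)) × (Fin M₂ × (Fin N → ℝ)) × (Fin N → ℝ) → ℝ≥0∞}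
    (hF : Measurable F) :
    ∫⁻ p, F p ∂(jointLaw ch N M₁ M₂) = ((M₁ : ℝ≥0∞) * M₂)⁻¹ * ∑ w₁, ∑ w₂,
      ∫⁻ s₁, ∫⁻ s₂, ∫⁻ z, F ((w₁, s₁), (w₂, s₂), z) ∂(whiteGaussian N ch.No)
        ∂(whiteGaussian N ch.Q₂) ∂(whiteGaussian N ch.Q₁) := by
  have := isProbabilityMeasure_userLaw N h₁ ch.Q₁
  have := isProbabilityMeasure_userLaw N h₂ ch.Q₂
  have hF' : ∀ a, Measurable fun q => F (a, q) := fun a => hF.comp measurable_prodMk_left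
  have hG : Measurable fun q : (Fin M₁ × (Fin N → ℝ)) × (Fin M₂ × (Fin N → ℝ)) =>
      ∫⁻ z, F (q.1, q.2, z) ∂(whiteGaussian N ch.No) :=
    Measurable.lintegral_prod_right' (f := fun r : ((Fin M₁ × (Fin N → ℝ)) ×
      (Fin M₂ × (Fin N → ℝ))) × (Fin N → ℝ) => F (r.1.1, r.1.2, r.2))
      (hF.comp (by fun_prop))
  rw [jointLaw, lintegral_prod _ hF.aemeasurable]
  simp_rw [fun a => lintegral_prod (μ := userLaw N M₂ ch.Q₂) (ν := whiteGaussian N ch.No)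
    (fun q => F (a, q)) (hF' a).aemeasurable]
  rw [lintegral_userLaw h₁ _ (Measurable.lintegral_prod_right' hG),
    ENNReal.mul_inv (by simp) (by simp), mul_assoc]
  congr 1
  rw [Finset.mul_sum]
  refine Finset.sum_congr rfl fun w₁ _ => ?_
  have : ∀ s₁, ∫⁻ q, ∫⁻ z, F ((w₁, s₁), q, z) ∂(whiteGaussian N ch.No) ∂(userLaw N M₂ ch.Q₂)
      = (M₂ : ℝ≥0∞)⁻¹ * ∑ w₂, ∫⁻ s₂, ∫⁻ z, F ((w₁, s₁), (w₂, s₂), z) ∂(whiteGaussian N ch.No)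
        ∂(whiteGaussian N ch.Q₂) := fun s₁ =>
    lintegral_userLaw h₂ _ (hG.comp measurable_prodMk_left)
  simp_rw [this]
  have hH : ∀ w₂, Measurable fun s₁ => ∫⁻ s₂, ∫⁻ z, F ((w₁, s₁), (w₂, s₂), z)
      ∂(whiteGaussian N ch.No) ∂(whiteGaussian N ch.Q₂) := fun w₂ =>
    Measurable.lintegral_prod_right' (f := fun r : (Fin N → ℝ) × (Fin N → ℝ) =>
      ∫⁻ z, F ((w₁, r.1), (w₂, r.2), z) ∂(whiteGaussian N ch.No))
      (hG.comp (by fun_prop : Measurable fun r : (Fin N → ℝ) × (Fin N → ℝ) =>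
        ((w₁, r.1), (w₂, r.2))))
  rw [lintegral_const_mul _ (Finset.measurable_sum _ fun w₂ _ => hH w₂),
    lintegral_finsetSum _ fun w₂ _ => hH w₂]

theorem memLp_enc {N M : ℕ} (hM : M ≠ 0) (hN : N ≠ 0) {v P : ℝ≥0}
    {enc : Fin M → (Fin N → ℝ) → (Fin N → ℝ)} (hm : ∀ w, Measurable (enc w))
    (hP : encPower v enc ≤ P) :
    (∀ n, MemLp (fun p : Fin M × (Fin N → ℝ) => enc p.1 p.2 n) 2 (userLaw N M v)) ∧
      ∑ n, ∫ p, enc p.1 p.2 n ^ 2 ∂(userLaw N M v) ≤ N * P := by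
  have hme : ∀ n, Measurable fun p : Fin M × (Fin N → ℝ) => enc p.1 p.2 n := fun n =>
    (measurable_pi_apply n).comp (measurable_from_prod_countable_right hm)
  have hsq : ∀ n, Measurable fun p : Fin M × (Fin N → ℝ) => ENNReal.ofReal (enc p.1 p.2 n ^ 2) :=
    fun n => ((hme n).pow_const 2).ennreal_ofReal
  have hsum : ∑ n, ∫⁻ p, ENNReal.ofReal (enc p.1 p.2 n ^ 2) ∂(userLaw N M v) ≤ N * P := by
    simp_rw [fun n => lintegral_userLaw hM v (hsq n)]
    rw [← Finset.mul_sum, Finset.sum_comm]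
    rw [encPower, ENNReal.div_le_iff (by simp [hM, hN])
      (ENNReal.mul_ne_top (by simp) (by simp))] at hP
    calc _ ≤ (M : ℝ≥0∞)⁻¹ * (P * (M * N)) := by gcongr
      _ = (M : ℝ≥0∞)⁻¹ * M * (N * P) := by ring
      _ = N * P := by rw [ENNReal.inv_mul_cancel (by simp [hM]) (by simp), one_mul]
  have hfin : ∀ n, ∫⁻ p, ENNReal.ofReal (enc p.1 p.2 n ^ 2) ∂(userLaw N M v) < ∞ := fun n =>
    ((Finset.single_le_sum (f := fun n => ∫⁻ p, ENNReal.ofReal (enc p.1 p.2 n ^ 2)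
      ∂(userLaw N M v)) (fun _ _ => zero_le) (Finset.mem_univ n)).trans hsum).trans_lt
      (ENNReal.mul_lt_top (by simp) (by simp))
  refine ⟨fun n => ?_, ?_⟩
  · rw [memLp_two_iff_integrable_sq (hme n).aestronglyMeasurable]
    refine ⟨((hme n).pow_const 2).aestronglyMeasurable, ?_⟩
    rw [hasFiniteIntegral_iff_ofReal (ae_of_all _ fun x => sq_nonneg _)]
    exact hfin n
  · simp_rw [fun n => integral_eq_lintegral_of_nonneg_ae
      (μ := userLaw N M v) (f := fun p => enc p.1 p.2 n ^ 2)
      (ae_of_all _ fun x => sq_nonneg _) ((hme n).pow_const 2).aestronglyMeasurable]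
    rw [← ENNReal.toReal_sum fun n _ => (hfin n).ne]
    have := ENNReal.toReal_mono (ENNReal.mul_ne_top (by simp) (by simp)) hsum
    simpa using this

/-! ### Second moments and expected log-likelihood ratios. -/

theorem integral_add_sq {α : Type*} [MeasurableSpace α] {μ : Measure α} {f g : α → ℝ}
    (hf : MemLp f 2 μ) (hg : MemLp g 2 μ) :
    ∫ x, (f x + g x) ^ 2 ∂μ = ∫ x, f x ^ 2 ∂μ + 2 * ∫ x, f x * g x ∂μ + ∫ x, g x ^ 2 ∂μ := by
  have e : ∀ x, (f x + g x) ^ 2 = f x ^ 2 + 2 * (f x * g x) + g x ^ 2 := fun x => by ring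
  have i : Integrable (fun x => 2 * (f x * g x)) μ := (hf.integrable_mul hg).const_mul 2
  have j : Integrable (fun x => f x ^ 2 + 2 * (f x * g x)) μ := hf.integrable_sq.add i
  simp_rw [e]
  rw [integral_add j hg.integrable_sq, integral_add hf.integrable_sq i, integral_const_mul]

/-- Second moment of a sum of independent square-integrable variables, two of them centred. -/
theorem integral_add_add_sq_prod {α β γ : Type*} [MeasurableSpace α] [MeasurableSpace β]
    [MeasurableSpace γ] {μ : Measure α} {ν : Measure β} {ρ : Measure γ} [IsProbabilityMeasure μ]
    [IsProbabilityMeasure ν] [IsProbabilityMeasure ρ] {f : α → ℝ} {g : β → ℝ} {h : γ → ℝ}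
    (hf : MemLp f 2 μ) (hg : MemLp g 2 ν) (hh : MemLp h 2 ρ) (f0 : ∫ x, f x ∂μ = 0)
    (h0 : ∫ x, h x ∂ρ = 0) :
    ∫ p, (f p.1 + g p.2.1 + h p.2.2) ^ 2 ∂(μ.prod (ν.prod ρ))
      = ∫ x, f x ^ 2 ∂μ + ∫ x, g x ^ 2 ∂ν + ∫ x, h x ^ 2 ∂ρ := by
  have hF : MemLp (fun p : α × β × γ => f p.1) 2 (μ.prod (ν.prod ρ)) := hf.comp_fst _
  have hGH : MemLp (fun q : β × γ => g q.1 + h q.2) 2 (ν.prod ρ) :=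
    (hg.comp_fst ρ).add (hh.comp_snd ν)
  have hGH' : MemLp (fun p : α × β × γ => g p.2.1 + h p.2.2) 2 (μ.prod (ν.prod ρ)) :=
    hGH.comp_snd μ
  have e1 : ∀ p : α × β × γ, (f p.1 + g p.2.1 + h p.2.2) ^ 2
      = (f p.1 + (g p.2.1 + h p.2.2)) ^ 2 := fun p => by ring
  simp_rw [e1]
  -- Each cross term has a centred factor, `f` or `h`, so `g` is free to have a nonzero mean.
  rw [integral_add_sq hF hGH',
    integral_prod_mul (μ := μ) (ν := ν.prod ρ) f (fun q => g q.1 + h q.2), f0,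
    integral_fun_fst (μ := μ) (ν := ν.prod ρ) (fun x => f x ^ 2),
    integral_fun_snd (μ := μ) (ν := ν.prod ρ) (fun q => (g q.1 + h q.2) ^ 2),
    integral_add_sq (hg.comp_fst ρ) (hh.comp_snd ν),
    integral_prod_mul (μ := ν) (ν := ρ) g h, h0,
    integral_fun_fst (μ := ν) (ν := ρ) (fun x => g x ^ 2),
    integral_fun_snd (μ := ν) (ν := ρ) (fun x => h x ^ 2)]
  simp
  ring

/-- The subtracted quadratic term has mean exactly `1 / 2` per symbol and the added one at most `N /
2` over the block, so only the logarithms survive. The output power is needed only summed over the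
block. -/
theorem integral_llr_le {Ω : Type*} [MeasurableSpace Ω] {P : Measure Ω} [IsProbabilityMeasure P]
    {N : ℕ} {v σ : ℝ} (hv : 0 < v) (hσ : 0 < σ) {Z T : Ω → Fin N → ℝ}
    (hZ : ∀ n, MemLp (fun x => Z x n) 2 P) (hT : ∀ n, MemLp (fun x => Z x n + T x n) 2 P)
    (eZ : ∀ n, ∫ x, Z x n ^ 2 ∂P = v) (eT : ∑ n, ∫ x, (Z x n + T x n) ^ 2 ∂P ≤ N * σ) :
    Integrable (fun x => llr v σ (Z x) (T x)) P ∧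
      ∫ x, llr v σ (Z x) (T x) ∂P ≤ N * (1 / 2 * Real.log (σ / v)) := by
  have iT := fun n => (hT n).integrable_sq.div_const (2 * σ)
  have iZ := fun n => (hZ n).integrable_sq.div_const (2 * v)
  have d : ∀ n, Integrable (fun x => (Z x n + T x n) ^ 2 / (2 * σ) - Z x n ^ 2 / (2 * v)) P :=
    fun n => (iT n).sub (iZ n)
  have i : ∀ n, Integrable (fun x => 1 / 2 * Real.log (σ / v) +
      ((Z x n + T x n) ^ 2 / (2 * σ) - Z x n ^ 2 / (2 * v))) P :=
    fun n => (integrable_const _).add (d n)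
  refine ⟨integrable_finsetSum _ fun n _ => i n, ?_⟩
  unfold llr
  have e : ∀ n, ∫ x, (1 / 2 * Real.log (σ / v) + ((Z x n + T x n) ^ 2 / (2 * σ) -
      Z x n ^ 2 / (2 * v))) ∂P = 1 / 2 * Real.log (σ / v) +
      ((∫ x, (Z x n + T x n) ^ 2 ∂P) / (2 * σ) - 1 / 2) := by
    intro n
    rw [integral_add (integrable_const _) (d n), integral_sub (iT n) (iZ n),
      integral_div, integral_div, eZ]
    simp
    field_simp
  rw [integral_finsetSum _ fun n _ => i n, Finset.sum_congr rfl fun n _ => e n,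
    Finset.sum_add_distrib, Finset.sum_sub_distrib, ← Finset.sum_div]
  have : (∑ n, ∫ x, (Z x n + T x n) ^ 2 ∂P) / (2 * σ) ≤ N * (1 / 2) := by
    rw [div_le_iff₀ (by positivity)]
    linarith
  simp only [Finset.sum_const, Finset.card_univ, Fintype.card_fin, nsmul_eq_mul]
  linarith

/-! ### The received block and the decoding error. -/

/-- Sample space of `((w₁, s₁), (w₂, s₂), z)`. -/
abbrev Sample (N M₁ M₂ : ℕ) : Type :=
  (Fin M₁ × (Fin N → ℝ)) × (Fin M₂ × (Fin N → ℝ)) × (Fin N → ℝ)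

/-- The received block as a random variable. -/
def received {N M₁ M₂ : ℕ} (c : Code N M₁ M₂) (p : Sample N M₁ M₂) : Fin N → ℝ :=
  output c p.1.1 p.2.1.1 p.1.2 p.2.1.2 p.2.2

theorem measurable_uncurry_fin {M : ℕ} {α β : Type*} [MeasurableSpace α] [MeasurableSpace β]
    {f : Fin M → α → β} (hf : ∀ w, Measurable (f w)) : Measurable fun p : Fin M × α => f p.1 p.2 :=
  measurable_from_prod_countable_right hf

theorem measurable_enc₁_sample {N M₁ M₂ : ℕ} (c : Code N M₁ M₂) :
    Measurable fun p : Sample N M₁ M₂ => c.enc₁ p.1.1 p.1.2 :=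
  (measurable_uncurry_fin c.measurable_enc₁).comp measurable_fst

theorem measurable_enc₂_sample {N M₁ M₂ : ℕ} (c : Code N M₁ M₂) :
    Measurable fun p : Sample N M₁ M₂ => c.enc₂ p.2.1.1 p.2.1.2 :=
  (measurable_uncurry_fin c.measurable_enc₂).comp (measurable_fst.comp measurable_snd)

theorem measurable_received {N M₁ M₂ : ℕ} (c : Code N M₁ M₂) : Measurable (received c) := by
  have h₁ := measurable_enc₁_sample c
  have h₂ := measurable_enc₂_sample c
  unfold received output
  fun_prop

theorem measurable_apply_received {N M₁ M₂ : ℕ} (c : Code N M₁ M₂)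
    {h : Fin M₁ → Fin M₂ → (Fin N → ℝ) → ℝ≥0∞} (hh : ∀ w₁ w₂, Measurable (h w₁ w₂)) :
    Measurable fun p : Sample N M₁ M₂ => h p.1.1 p.2.1.1 (received c p) := by
  have h1 : Measurable fun q : Fin M₁ × Fin M₂ × (Fin N → ℝ) => h q.1 q.2.1 q.2.2 :=
    measurable_uncurry_fin (f := fun w₁ (q : Fin M₂ × (Fin N → ℝ)) => h w₁ q.1 q.2)
      fun w₁ => measurable_uncurry_fin (hh w₁)
  have := measurable_received c
  exact h1.comp (by fun_prop : Measurable fun p : Sample N M₁ M₂ =>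
    (p.1.1, p.2.1.1, received c p))

theorem measure_prod_prod_eq_lintegral {α β γ : Type*} [MeasurableSpace α] [MeasurableSpace β]
    [MeasurableSpace γ] (μ : Measure α) (ν : Measure β) (ρ : Measure γ) [SFinite μ] [SFinite ν]
    [SFinite ρ] {B : Set (α × β × γ)} (hB : MeasurableSet B) :
    (μ.prod (ν.prod ρ)) B = ∫⁻ a, ∫⁻ b, ∫⁻ u, B.indicator 1 (a, b, u) ∂ρ ∂ν ∂μ := by
  have hm : Measurable (B.indicator (1 : α × β × γ → ℝ≥0∞)) := measurable_one.indicator hB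
  rw [← lintegral_indicator_one hB, lintegral_prod _ hm.aemeasurable]
  refine lintegral_congr fun a => ?_
  have hma : Measurable fun q => B.indicator (1 : α × β × γ → ℝ≥0∞) (a, q) :=
    hm.comp measurable_prodMk_left
  rw [lintegral_prod _ hma.aemeasurable]

theorem jointLaw_error (ch : DirtyMAC) {N M₁ M₂ : ℕ} (h₁ : M₁ ≠ 0) (h₂ : M₂ ≠ 0)
    (c : Code N M₁ M₂) :
    jointLaw ch N M₁ M₂ {p | c.dec (received c p) ≠ (p.1.1, p.2.1.1)} = ch.errorProb c := by
  have hdec : Measurable fun p : Sample N M₁ M₂ => c.dec (received c p) :=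
    c.measurable_dec.comp (measurable_received c)
  have hA : MeasurableSet {p : Sample N M₁ M₂ | c.dec (received c p) ≠ (p.1.1, p.2.1.1)} :=
    (measurableSet_eq_fun hdec (by fun_prop)).compl
  rw [← lintegral_indicator_one hA, lintegral_jointLaw ch h₁ h₂ (measurable_one.indicator hA),
    errorProb, ENNReal.div_eq_inv_mul]
  congr 1
  refine Finset.sum_congr rfl fun w₁ _ => Finset.sum_congr rfl fun w₂ _ => ?_
  have hm : Measurable fun b : (Fin N → ℝ) × (Fin N → ℝ) × (Fin N → ℝ) =>
      (((w₁, b.1), (w₂, b.2.1), b.2.2) : Sample N M₁ M₂) := by fun_prop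
  have hB : MeasurableSet {b : (Fin N → ℝ) × (Fin N → ℝ) × (Fin N → ℝ) |
      c.dec (output c w₁ w₂ b.1 b.2.1 b.2.2) ≠ (w₁, w₂)} := hm hA
  rw [blockLaw, measure_prod_prod_eq_lintegral _ _ _ hB]
  rfl

/-- Under a law of the blocks that ignores the index `i`, guessing `i` succeeds with total
mass one. -/
theorem sum_lintegral_indicator {I α β γ : Type*} [Fintype I] [MeasurableSpace I]
    [MeasurableSingletonClass I] [MeasurableSpace α] [MeasurableSpace β] [MeasurableSpace γ]
    (μ : Measure α) (ν : Measure β) (ρ : Measure γ) [IsProbabilityMeasure μ]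
    [IsProbabilityMeasure ν] [IsProbabilityMeasure ρ] {G : α × β × γ → I} (hG : Measurable G) :
    ∑ i, ∫⁻ a, ∫⁻ b, ∫⁻ u, ({i} : Set I).indicator 1 (G (a, b, u)) ∂ρ ∂ν ∂μ = 1 := by
  have h : ∀ i, ∫⁻ a, ∫⁻ b, ∫⁻ u, ({i} : Set I).indicator 1 (G (a, b, u)) ∂ρ ∂ν ∂μ
      = (μ.prod (ν.prod ρ)) (G ⁻¹' {i}) := by
    intro i
    have hB : MeasurableSet (G ⁻¹' {i}) := hG (measurableSet_singleton i)
    rw [measure_prod_prod_eq_lintegral _ _ _ hB]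
    rfl
  simp_rw [h]
  rw [sum_measure_preimage_singleton _ fun i _ => hG (measurableSet_singleton i)]
  simp

/-! ### Reference laws and the bounds on message counts. -/

/-- `IsReference ch c L G σ`: the density `exp (-L)` turns the joint law into one under which the
received block is `G w₁ s₁ s₂ u`, where `u` is white Gaussian of variance `σ`, and the messages
are still uniform. -/
def IsReference (ch : DirtyMAC) {N M₁ M₂ : ℕ} (c : Code N M₁ M₂) (L : Sample N M₁ M₂ → ℝ)
    (G : Fin M₁ → (Fin N → ℝ) × (Fin N → ℝ) × (Fin N → ℝ) → (Fin N → ℝ)) (σ : ℝ≥0) : Prop :=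
  ∀ h : Fin M₁ → Fin M₂ → (Fin N → ℝ) → ℝ≥0∞, (∀ w₁ w₂, Measurable (h w₁ w₂)) →
    ∫⁻ p, ENNReal.ofReal (Real.exp (-L p)) * h p.1.1 p.2.1.1 (received c p) ∂(jointLaw ch N M₁ M₂)
      = ((M₁ : ℝ≥0∞) * M₂)⁻¹ * ∑ w₁, ∑ w₂, ∫⁻ s₁, ∫⁻ s₂, ∫⁻ u, h w₁ w₂ (G w₁ (s₁, s₂, u))
        ∂(whiteGaussian N σ) ∂(whiteGaussian N ch.Q₂) ∂(whiteGaussian N ch.Q₁)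

section

variable {ch : DirtyMAC} {N M₁ M₂ : ℕ} {c : Code N M₁ M₂} {L : Sample N M₁ M₂ → ℝ}
  {G : Fin M₁ → (Fin N → ℝ) × (Fin N → ℝ) × (Fin N → ℝ) → (Fin N → ℝ)} {σ : ℝ≥0}

theorem IsReference.lintegral_le_one (hR : IsReference ch c L G σ) (h₁ : M₁ ≠ 0) (h₂ : M₂ ≠ 0) :
    ∫⁻ p, ENNReal.ofReal (Real.exp (-L p)) ∂(jointLaw ch N M₁ M₂) ≤ 1 := by
  have := hR (fun _ _ _ => 1) fun _ _ => measurable_const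
  simp only [mul_one] at this
  rw [this]
  simp only [lintegral_const, measure_univ, mul_one, Finset.sum_const, Finset.card_univ,
    Fintype.card_fin, nsmul_eq_mul]
  rw [ENNReal.inv_mul_cancel (by simp [h₁, h₂]) (ENNReal.mul_ne_top (by simp) (by simp))]

/-- `B w₁ w₂` is the set of decoder outputs counted as success, which covers decoding the pair and
decoding `w₂` alone. -/
theorem IsReference.setLIntegral (hR : IsReference ch c L G σ)
    {B : Fin M₁ → Fin M₂ → Set (Fin M₁ × Fin M₂)} :
    ∫⁻ p in {p | c.dec (received c p) ∈ B p.1.1 p.2.1.1}, ENNReal.ofReal (Real.exp (-L p))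
        ∂(jointLaw ch N M₁ M₂)
      = ((M₁ : ℝ≥0∞) * M₂)⁻¹ * ∑ w₁, ∑ w₂, ∫⁻ s₁, ∫⁻ s₂, ∫⁻ u,
        (B w₁ w₂).indicator 1 (c.dec (G w₁ (s₁, s₂, u)))
        ∂(whiteGaussian N σ) ∂(whiteGaussian N ch.Q₂) ∂(whiteGaussian N ch.Q₁) := by
  have hm : ∀ w₁ w₂, Measurable fun y => (B w₁ w₂).indicator (1 : Fin M₁ × Fin M₂ → ℝ≥0∞) (c.dec y) :=
    fun w₁ w₂ => (measurable_of_countable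
      ((B w₁ w₂).indicator (1 : Fin M₁ × Fin M₂ → ℝ≥0∞))).comp c.measurable_dec
  have hA : MeasurableSet {p : Sample N M₁ M₂ | c.dec (received c p) ∈ B p.1.1 p.2.1.1} := by
    have h1 := measurable_apply_received c hm
    convert h1 (measurableSet_singleton 1) using 1
    ext p
    by_cases hp : c.dec (received c p) ∈ B p.1.1 p.2.1.1 <;> simp [hp]
  rw [← hR (fun w₁ w₂ y => (B w₁ w₂).indicator 1 (c.dec y)) hm, ← lintegral_indicator hA]
  refine lintegral_congr fun p => ?_
  by_cases hp : c.dec (received c p) ∈ B p.1.1 p.2.1.1 <;> simp [hp]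

/-- Correct decoding forces `A`, hence `P(A) ≥ 1 - ε`. -/
theorem one_sub_mul_log_le (hLm : Measurable L) (hL : Integrable L (jointLaw ch N M₁ M₂))
    (h₁ : M₁ ≠ 0) (h₂ : M₂ ≠ 0) {ε : ℝ} (hε : 0 ≤ ε) (herr : ch.errorProb c ≤ ENNReal.ofReal ε)
    (hR : IsReference ch c L G σ) {M : ℝ} (hM : 1 ≤ M) {A : Set (Sample N M₁ M₂)}
    (hA : MeasurableSet A) (hsub : ∀ p, c.dec (received c p) = (p.1.1, p.2.1.1) → p ∈ A)
    (hgu : ∫⁻ p in A, ENNReal.ofReal (Real.exp (-L p)) ∂(jointLaw ch N M₁ M₂) ≤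
      ENNReal.ofReal M⁻¹) :
    (1 - ε) * Real.log M ≤ ∫ p, L p ∂(jointLaw ch N M₁ M₂) + Real.log 2 := by
  have := isProbabilityMeasure_jointLaw ch N h₁ h₂
  refine le_trans ?_ (prob_mul_log_le _ hA hLm hL hM (hR.lintegral_le_one h₁ h₂) hgu)
  refine mul_le_mul_of_nonneg_right ?_ (Real.log_nonneg hM)
  have hc : (jointLaw ch N M₁ M₂).real Aᶜ ≤ ε := by
    refine ENNReal.toReal_le_of_le_ofReal hε (le_trans (measure_mono ?_)
      ((jointLaw_error ch h₁ h₂ c).le.trans herr))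
    exact fun p hp heq => hp (hsub p heq)
  rw [probReal_compl_eq_one_sub hA] at hc
  linarith

/-- The reference output ignores both messages, so the success probabilities of the `M₁ M₂` pairs
sum to one. -/
theorem log_mul_le (hLm : Measurable L) (hL : Integrable L (jointLaw ch N M₁ M₂))
    (h₁ : M₁ ≠ 0) (h₂ : M₂ ≠ 0) {ε : ℝ} (hε : 0 ≤ ε) (herr : ch.errorProb c ≤ ENNReal.ofReal ε)
    {g : (Fin N → ℝ) × (Fin N → ℝ) × (Fin N → ℝ) → (Fin N → ℝ)} (hg : Measurable g)
    (hR : IsReference ch c L (fun _ => g) σ) :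
    (1 - ε) * Real.log (M₁ * M₂) ≤ ∫ p, L p ∂(jointLaw ch N M₁ M₂) + Real.log 2 := by
  have h₁' : (1 : ℝ) ≤ M₁ := by exact_mod_cast Nat.one_le_iff_ne_zero.2 h₁
  have h₂' : (1 : ℝ) ≤ M₂ := by exact_mod_cast Nat.one_le_iff_ne_zero.2 h₂
  have hm := c.measurable_dec.comp (measurable_received c)
  refine one_sub_mul_log_le hLm hL h₁ h₂ hε herr hR (one_le_mul_of_one_le_of_one_le h₁' h₂')
    (A := {p | c.dec (received c p) ∈ ({(p.1.1, p.2.1.1)} : Set _)})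
    (measurableSet_eq_fun hm (by fun_prop)) (fun p hp => hp) ?_
  have hgu := sum_lintegral_indicator (whiteGaussian N ch.Q₁) (whiteGaussian N ch.Q₂)
    (whiteGaussian N σ) (c.measurable_dec.comp hg)
  simp only [Function.comp_apply] at hgu
  rw [hR.setLIntegral (B := fun w₁ w₂ => {(w₁, w₂)}),
    ← Fintype.sum_prod_type' (f := fun w₁ w₂ => ∫⁻ s₁, ∫⁻ s₂, ∫⁻ u,
      ({(w₁, w₂)} : Set (Fin M₁ × Fin M₂)).indicator 1 (c.dec (g (s₁, s₂, u)))
        ∂(whiteGaussian N σ) ∂(whiteGaussian N ch.Q₂) ∂(whiteGaussian N ch.Q₁)),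
    hgu, mul_one,
    ENNReal.ofReal_inv_of_pos (by positivity), ENNReal.ofReal_mul (by positivity)]
  simp

/-- Only `w₂` is guessed, so the reference output may depend on `w₁`: for each `w₁` the success
probabilities over `w₂` sum to one. -/
theorem log_snd_le (hLm : Measurable L) (hL : Integrable L (jointLaw ch N M₁ M₂))
    (h₁ : M₁ ≠ 0) (h₂ : M₂ ≠ 0) {ε : ℝ} (hε : 0 ≤ ε) (herr : ch.errorProb c ≤ ENNReal.ofReal ε)
    (hG : ∀ w₁, Measurable (G w₁)) (hR : IsReference ch c L G σ) :
    (1 - ε) * Real.log M₂ ≤ ∫ p, L p ∂(jointLaw ch N M₁ M₂) + Real.log 2 := by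
  have h₂' : (1 : ℝ) ≤ M₂ := by exact_mod_cast Nat.one_le_iff_ne_zero.2 h₂
  have hm := c.measurable_dec.comp (measurable_received c)
  refine one_sub_mul_log_le hLm hL h₁ h₂ hε herr hR h₂'
    (A := {p | c.dec (received c p) ∈ (Prod.snd ⁻¹' {p.2.1.1} : Set (Fin M₁ × Fin M₂))})
    (measurableSet_eq_fun (measurable_snd.comp hm) (by fun_prop)) (fun p hp => by simp [hp]) ?_
  rw [hR.setLIntegral (B := fun _ w₂ => Prod.snd ⁻¹' {w₂})]
  have e : ∀ w₁, ∑ w₂, ∫⁻ s₁, ∫⁻ s₂, ∫⁻ u,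
      (Prod.snd ⁻¹' {w₂}).indicator (1 : Fin M₁ × Fin M₂ → ℝ≥0∞)
        (c.dec (G w₁ (s₁, s₂, u)))
        ∂(whiteGaussian N σ) ∂(whiteGaussian N ch.Q₂) ∂(whiteGaussian N ch.Q₁) = 1 :=
    fun w₁ => sum_lintegral_indicator _ _ _ (measurable_snd.comp (c.measurable_dec.comp (hG w₁)))
  rw [Finset.sum_congr rfl fun w₁ _ => e w₁, ENNReal.mul_inv (by simp) (by simp),
    ENNReal.ofReal_inv_of_pos (by positivity)]
  simp only [Finset.sum_const, Finset.card_univ, Fintype.card_fin, nsmul_eq_mul, mul_one,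
    ENNReal.ofReal_natCast]
  rw [mul_right_comm, ENNReal.inv_mul_cancel (by simp [h₁]) (by simp), one_mul]

end

/-! ### The two information densities. -/

section

variable (ch : DirtyMAC) {N M₁ M₂ : ℕ} (c : Code N M₁ M₂)

/-- Information density for a receiver that is told both interferences, with reference output
centred at `κ w₁ s₁ + s₁ + s₂`. -/
def cleanDensity (κ : Fin M₁ → (Fin N → ℝ) → (Fin N → ℝ)) (σ : ℝ≥0) (p : Sample N M₁ M₂) : ℝ :=
  llr ch.No σ p.2.2 (c.enc₁ p.1.1 p.1.2 + c.enc₂ p.2.1.1 p.2.1.2 - κ p.1.1 p.1.2)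

theorem measurable_cleanDensity {κ : Fin M₁ → (Fin N → ℝ) → (Fin N → ℝ)}
    (hκ : ∀ w, Measurable (κ w)) (σ : ℝ≥0) : Measurable (cleanDensity ch c κ σ) := by
  have hκ' : Measurable fun p : Sample N M₁ M₂ => κ p.1.1 p.1.2 :=
    (measurable_uncurry_fin hκ).comp measurable_fst
  exact measurable_llr _ _ (by fun_prop)
    (((measurable_enc₁_sample c).add (measurable_enc₂_sample c)).sub hκ')

/-- With messages and interferences fixed, only the noise is tilted: `z + x₁ + x₂ - κ` becomes white
of variance `σ`, and the output is its translate by `κ + s₁ + s₂`. -/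
theorem isReference_cleanDensity (h₁ : M₁ ≠ 0) (h₂ : M₂ ≠ 0)
    {κ : Fin M₁ → (Fin N → ℝ) → (Fin N → ℝ)} (hκ : ∀ w, Measurable (κ w)) {σ : ℝ≥0} (hσ : 0 < σ) :
    IsReference ch c (cleanDensity ch c κ σ)
      (fun w₁ q => q.2.2 + (κ w₁ q.1 + q.1 + q.2.1)) σ := by
  intro h hh
  have hm : Measurable fun p => ENNReal.ofReal (Real.exp (-cleanDensity ch c κ σ p)) *
      h p.1.1 p.2.1.1 (received c p) :=
    (Real.measurable_exp.comp (measurable_cleanDensity ch c hκ σ).neg).ennreal_ofReal.mul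
      (measurable_apply_received c hh)
  rw [lintegral_jointLaw ch h₁ h₂ hm]
  congr 1
  refine Finset.sum_congr rfl fun w₁ _ => Finset.sum_congr rfl fun w₂ _ =>
    lintegral_congr fun s₁ => lintegral_congr fun s₂ => ?_
  have hf : Measurable fun u => h w₁ w₂ (u + (κ w₁ s₁ + s₁ + s₂)) :=
    (hh w₁ w₂).comp (by fun_prop)
  rw [← lintegral_exp_neg_llr ch.No_pos hσ (c.enc₁ w₁ s₁ + c.enc₂ w₂ s₂ - κ w₁ s₁) hf]
  refine lintegral_congr fun z => ?_
  simp only [cleanDensity, received, output]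
  congr 2
  abel

/-- Information density for a receiver that is told `s₁` and, from the reference output, estimates
`s₂` by `a (y - x₁ - s₁)`. -/
def dirtyDensity (m : Fin N → ℝ) (a : ℝ) (σ D : ℝ≥0) (p : Sample N M₁ M₂) : ℝ :=
  llr ch.No σ p.2.2 (c.enc₁ p.1.1 p.1.2 - m + c.enc₂ p.2.1.1 p.2.1.2 + p.2.1.2) +
    llr ch.Q₂ D p.2.1.2 (-a • (c.enc₂ p.2.1.1 p.2.1.2 + p.2.1.2 + p.2.2))

theorem measurable_dirtyDensity (m : Fin N → ℝ) (a : ℝ) (σ D : ℝ≥0) :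
    Measurable (dirtyDensity ch c m a σ D) := by
  have e₁ := measurable_enc₁_sample c
  have e₂ := measurable_enc₂_sample c
  exact (measurable_llr _ _ (by fun_prop) (by fun_prop)).add
    (measurable_llr _ _ (by fun_prop) (by fun_prop))

/-- For fixed `s₂` the first factor makes `u = y - m - s₁` white of variance `σ`. The estimate then
depends on `u` and `x₁` but not on `s₂`, so after exchanging the integrals the second factor
integrates over `s₂` to one. -/
theorem isReference_dirtyDensity (h₁ : M₁ ≠ 0) (h₂ : M₂ ≠ 0) (hQ : 0 < ch.Q₂) (m : Fin N → ℝ)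
    (a : ℝ) {σ D : ℝ≥0} (hσ : 0 < σ) (hD : 0 < D) :
    IsReference ch c (dirtyDensity ch c m a σ D) (fun _ q => q.2.2 + (m + q.1)) σ := by
  intro h hh
  have hm : Measurable fun p => ENNReal.ofReal (Real.exp (-dirtyDensity ch c m a σ D p)) *
      h p.1.1 p.2.1.1 (received c p) :=
    (Real.measurable_exp.comp (measurable_dirtyDensity ch c m a σ D).neg).ennreal_ofReal.mul
      (measurable_apply_received c hh)
  rw [lintegral_jointLaw ch h₁ h₂ hm]
  congr 1
  refine Finset.sum_congr rfl fun w₁ _ => Finset.sum_congr rfl fun w₂ _ =>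
    lintegral_congr fun s₁ => ?_
  have hH : Measurable fun u => h w₁ w₂ (u + (m + s₁)) := (hh w₁ w₂).comp (by fun_prop)
  have hE : Measurable fun q : (Fin N → ℝ) × (Fin N → ℝ) => ENNReal.ofReal (Real.exp
      (-llr ch.Q₂ D q.1 (-a • (q.2 - c.enc₁ w₁ s₁ + m)))) :=
    (Real.measurable_exp.comp (measurable_llr _ _ (by fun_prop)
      (by fun_prop)).neg).ennreal_ofReal
  have hEH : Measurable fun q : (Fin N → ℝ) × (Fin N → ℝ) => ENNReal.ofReal (Real.exp
      (-llr ch.Q₂ D q.1 (-a • (q.2 - c.enc₁ w₁ s₁ + m)))) * h w₁ w₂ (q.2 + (m + s₁)) :=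
    hE.mul (hH.comp measurable_snd)
  have step : ∀ s₂, ∫⁻ z, ENNReal.ofReal (Real.exp
      (-dirtyDensity ch c m a σ D ((w₁, s₁), (w₂, s₂), z))) *
        h w₁ w₂ (received c ((w₁, s₁), (w₂, s₂), z)) ∂(whiteGaussian N ch.No)
      = ∫⁻ u, ENNReal.ofReal (Real.exp (-llr ch.Q₂ D s₂ (-a • (u - c.enc₁ w₁ s₁ + m)))) *
        h w₁ w₂ (u + (m + s₁)) ∂(whiteGaussian N σ) := by
    intro s₂
    have hf : Measurable fun u => ENNReal.ofReal (Real.exp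
        (-llr ch.Q₂ D s₂ (-a • (u - c.enc₁ w₁ s₁ + m)))) * h w₁ w₂ (u + (m + s₁)) :=
      (Real.measurable_exp.comp (measurable_llr _ _ (by fun_prop)
        (by fun_prop)).neg).ennreal_ofReal.mul hH
    refine Eq.trans (lintegral_congr fun z => ?_) (lintegral_exp_neg_llr ch.No_pos hσ
      (c.enc₁ w₁ s₁ - m + c.enc₂ w₂ s₂ + s₂) hf)
    simp only [dirtyDensity, received, output]
    have ea : z + (c.enc₁ w₁ s₁ - m + c.enc₂ w₂ s₂ + s₂) - c.enc₁ w₁ s₁ + m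
        = c.enc₂ w₂ s₂ + s₂ + z := by abel
    have eb : z + (c.enc₁ w₁ s₁ - m + c.enc₂ w₂ s₂ + s₂) + (m + s₁)
        = c.enc₁ w₁ s₁ + c.enc₂ w₂ s₂ + s₁ + s₂ + z := by abel
    rw [ea, eb, neg_add, Real.exp_add, ENNReal.ofReal_mul (Real.exp_pos _).le, mul_assoc]
  simp_rw [step]
  rw [lintegral_lintegral_swap hEH.aemeasurable, lintegral_const, measure_univ, mul_one]
  refine lintegral_congr fun u => ?_
  have := lintegral_exp_neg_llr hQ hD (-a • (u - c.enc₁ w₁ s₁ + m))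
    (measurable_const (a := h w₁ w₂ (u + (m + s₁))))
  rwa [lintegral_const, measure_univ, mul_one] at this

/-! ### Expected information densities under the power constraints. -/

/-- A deterministic `m` can be built into the reference centre. Centring removes the cross terms of
`x₁` with `x₂` and `s₂`, and does not increase the power. -/
theorem memLp_enc_sub_mean (h₁ : M₁ ≠ 0) (hN : N ≠ 0)
    (hP₁ : encPower ch.Q₁ c.enc₁ ≤ (ch.P₁ : ℝ≥0∞)) :
    ∃ m : Fin N → ℝ,
      (∀ n, MemLp (fun p : Fin M₁ × (Fin N → ℝ) => c.enc₁ p.1 p.2 n - m n) 2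
        (userLaw N M₁ ch.Q₁)) ∧
      (∀ n, ∫ p, (c.enc₁ p.1 p.2 n - m n) ∂(userLaw N M₁ ch.Q₁) = 0) ∧
      ∑ n, ∫ p, (c.enc₁ p.1 p.2 n - m n) ^ 2 ∂(userLaw N M₁ ch.Q₁) ≤ N * ch.P₁ := by
  have := isProbabilityMeasure_userLaw N h₁ ch.Q₁
  obtain ⟨hL, hs⟩ := memLp_enc h₁ hN c.measurable_enc₁ hP₁
  refine ⟨fun n => ∫ p, c.enc₁ p.1 p.2 n ∂(userLaw N M₁ ch.Q₁),
    fun n => (hL n).sub (memLp_const _), fun n => ?_, le_trans (Finset.sum_le_sum fun n _ => ?_) hs⟩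
  · rw [integral_sub ((hL n).integrable (by norm_num)) (integrable_const _)]
    simp
  · rw [← variance_eq_integral (hL n).aestronglyMeasurable.aemeasurable]
    exact variance_le_expectation_sq (hL n).aestronglyMeasurable

/-- `g` may mix the dependent variables `x₂` and `s₂`. The coefficient `b` is `1` for the output,
`-a` for the estimation error and `0` without noise. -/
theorem integral_add_enc₂_add_noise_sq (h₁ : M₁ ≠ 0) (h₂ : M₂ ≠ 0)
    {f : Fin M₁ × (Fin N → ℝ) → ℝ} (hf : MemLp f 2 (userLaw N M₁ ch.Q₁))
    (f0 : ∫ p, f p ∂(userLaw N M₁ ch.Q₁) = 0) {g : Fin M₂ × (Fin N → ℝ) → ℝ}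
    (hg : MemLp g 2 (userLaw N M₂ ch.Q₂)) (b : ℝ) (n : Fin N) :
    MemLp (fun p : Sample N M₁ M₂ => f p.1 + g p.2.1 + b * p.2.2 n) 2 (jointLaw ch N M₁ M₂) ∧
    ∫ p, (f p.1 + g p.2.1 + b * p.2.2 n) ^ 2 ∂(jointLaw ch N M₁ M₂)
      = ∫ p, f p ^ 2 ∂(userLaw N M₁ ch.Q₁) + ∫ p, g p ^ 2 ∂(userLaw N M₂ ch.Q₂)
        + b ^ 2 * ch.No := by
  have := isProbabilityMeasure_userLaw N h₁ ch.Q₁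
  have := isProbabilityMeasure_userLaw N h₂ ch.Q₂
  have hz := (memLp_whiteGaussian_apply N ch.No n).const_mul b
  refine ⟨((hf.comp_fst _).add ((hg.comp_fst _).comp_snd _)).add ((hz.comp_snd _).comp_snd _), ?_⟩
  rw [jointLaw, integral_add_add_sq_prod (h := fun z : Fin N → ℝ => b * z n) hf hg hz f0
    (by rw [integral_const_mul, integral_whiteGaussian_apply, mul_zero])]
  simp_rw [mul_pow]
  rw [integral_const_mul, integral_whiteGaussian_apply_sq]

theorem noise_jointLaw (h₁ : M₁ ≠ 0) (h₂ : M₂ ≠ 0) (n : Fin N) :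
    MemLp (fun p : Sample N M₁ M₂ => p.2.2 n) 2 (jointLaw ch N M₁ M₂) ∧
      ∫ p, p.2.2 n ^ 2 ∂(jointLaw ch N M₁ M₂) = ch.No := by
  have h := integral_add_enc₂_add_noise_sq ch h₁ h₂ (f := 0) (g := 0) MemLp.zero (by simp)
    MemLp.zero 1 n
  simpa using h

theorem integral_cleanDensity_le (h₁ : M₁ ≠ 0) (h₂ : M₂ ≠ 0) (hN : N ≠ 0)
    (hP₂ : encPower ch.Q₂ c.enc₂ ≤ (ch.P₂ : ℝ≥0∞))
    {κ : Fin M₁ → (Fin N → ℝ) → (Fin N → ℝ)} {P σ : ℝ≥0}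
    (hf : ∀ n, MemLp (fun p : Fin M₁ × (Fin N → ℝ) => c.enc₁ p.1 p.2 n - κ p.1 p.2 n) 2
      (userLaw N M₁ ch.Q₁))
    (f0 : ∀ n, ∫ p, (c.enc₁ p.1 p.2 n - κ p.1 p.2 n) ∂(userLaw N M₁ ch.Q₁) = 0)
    (hfP : ∑ n, ∫ p, (c.enc₁ p.1 p.2 n - κ p.1 p.2 n) ^ 2 ∂(userLaw N M₁ ch.Q₁) ≤ N * P)
    (hσ : σ = P + ch.P₂ + ch.No) :
    Integrable (cleanDensity ch c κ σ) (jointLaw ch N M₁ M₂) ∧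
      ∫ p, cleanDensity ch c κ σ p ∂(jointLaw ch N M₁ M₂) ≤
        N * (1 / 2 * Real.log (σ / ch.No)) := by
  have := isProbabilityMeasure_jointLaw ch N h₁ h₂
  obtain ⟨hg, hgP⟩ := memLp_enc h₂ hN c.measurable_enc₂ hP₂
  have key := fun n => integral_add_enc₂_add_noise_sq ch h₁ h₂ (hf n) (f0 n) (hg n) 1 n
  have e : ∀ n (p : Sample N M₁ M₂), p.2.2 n +
      (c.enc₁ p.1.1 p.1.2 + c.enc₂ p.2.1.1 p.2.1.2 - κ p.1.1 p.1.2) n =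
      c.enc₁ p.1.1 p.1.2 n - κ p.1.1 p.1.2 n + c.enc₂ p.2.1.1 p.2.1.2 n + 1 * p.2.2 n := by
    intro n p
    simp only [Pi.add_apply, Pi.sub_apply]
    ring
  have hσ0 : 0 < σ := hσ ▸ add_pos_of_nonneg_of_pos zero_le ch.No_pos
  refine integral_llr_le (NNReal.coe_pos.2 ch.No_pos) (NNReal.coe_pos.2 hσ0)
    (fun n => (noise_jointLaw ch h₁ h₂ n).1) (fun n => ?_)
    (fun n => (noise_jointLaw ch h₁ h₂ n).2) ?_
  · simp_rw [e]
    exact (key n).1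
  · simp_rw [e, fun n => (key n).2]
    rw [Finset.sum_add_distrib, Finset.sum_add_distrib, hσ]
    push_cast
    simp only [Finset.sum_const, Finset.card_univ, Fintype.card_fin, nsmul_eq_mul]
    linarith

/-- Only the product `σ D` matters: positive correlation of `x₂` with `s₂` raises the output power
but makes `s₂` easier to estimate. -/
theorem integral_dirtyDensity_le (h₁ : M₁ ≠ 0) (h₂ : M₂ ≠ 0) (hN : N ≠ 0) (hQ : 0 < ch.Q₂)
    (hP₂ : encPower ch.Q₂ c.enc₂ ≤ (ch.P₂ : ℝ≥0∞)) {m : Fin N → ℝ}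
    (hf : ∀ n, MemLp (fun p : Fin M₁ × (Fin N → ℝ) => c.enc₁ p.1 p.2 n - m n) 2
      (userLaw N M₁ ch.Q₁))
    (f0 : ∀ n, ∫ p, (c.enc₁ p.1 p.2 n - m n) ∂(userLaw N M₁ ch.Q₁) = 0)
    (hfP : ∑ n, ∫ p, (c.enc₁ p.1 p.2 n - m n) ^ 2 ∂(userLaw N M₁ ch.Q₁) ≤ N * ch.P₁) :
    ∃ (a : ℝ) (σ D : ℝ≥0), 0 < σ ∧ 0 < D ∧
      Integrable (dirtyDensity ch c m a σ D) (jointLaw ch N M₁ M₂) ∧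
      ∫ p, dirtyDensity ch c m a σ D p ∂(jointLaw ch N M₁ M₂) ≤
        N * (1 / 2 * Real.log ((ch.P₁ + ch.P₂ + ch.Q₂ + ch.No) / ch.Q₂) +
          1 / 2 * Real.log ((ch.P₂ + ch.No) / ch.No)) := by
  have := isProbabilityMeasure_jointLaw ch N h₁ h₂
  have := isProbabilityMeasure_userLaw N h₂ ch.Q₂
  have := isProbabilityMeasure_uniform h₂
  obtain ⟨hx, hxP⟩ := memLp_enc h₂ hN c.measurable_enc₂ hP₂
  have hs : ∀ n, MemLp (fun p : Fin M₂ × (Fin N → ℝ) => p.2 n) 2 (userLaw N M₂ ch.Q₂) := fun n =>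
    (memLp_whiteGaussian_apply N ch.Q₂ n).comp_snd _
  have hs2 : ∀ n, ∫ p, p.2 n ^ 2 ∂(userLaw N M₂ ch.Q₂) = ch.Q₂ := by
    intro n
    rw [userLaw, integral_fun_snd (fun s : Fin N → ℝ => s n ^ 2), integral_whiteGaussian_apply_sq]
    simp
  set S := ∑ n, ∫ p, c.enc₂ p.1 p.2 n ^ 2 ∂(userLaw N M₂ ch.Q₂) with hS
  set C := ∑ n, ∫ p, c.enc₂ p.1 p.2 n * p.2 n ∂(userLaw N M₂ ch.Q₂) with hC
  have comb : ∀ α β : ℝ, ∑ n, ∫ p, (α * c.enc₂ p.1 p.2 n + β * p.2 n) ^ 2 ∂(userLaw N M₂ ch.Q₂)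
      = α ^ 2 * S + 2 * α * β * C + N * (β ^ 2 * ch.Q₂) := by
    intro α β
    have : ∀ n, ∫ p, (α * c.enc₂ p.1 p.2 n + β * p.2 n) ^ 2 ∂(userLaw N M₂ ch.Q₂)
        = α ^ 2 * ∫ p, c.enc₂ p.1 p.2 n ^ 2 ∂(userLaw N M₂ ch.Q₂) +
          2 * α * β * ∫ p, c.enc₂ p.1 p.2 n * p.2 n ∂(userLaw N M₂ ch.Q₂) + β ^ 2 * ch.Q₂ := by
      intro n
      rw [integral_add_sq ((hx n).const_mul α) ((hs n).const_mul β)]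
      simp_rw [mul_pow, mul_mul_mul_comm α]
      rw [integral_const_mul, integral_const_mul, integral_const_mul, hs2]
      ring
    simp_rw [this]
    rw [Finset.sum_add_distrib, Finset.sum_add_distrib, ← Finset.mul_sum, ← Finset.mul_sum, hS, hC]
    simp
  -- any parameters meeting the two second-moment constraints give a bound
  have main : ∀ (a : ℝ) (σ D : ℝ≥0), 0 < σ → 0 < D →
      N * ch.P₁ + (S + 2 * C + N * ch.Q₂) + N * ch.No ≤ N * (σ : ℝ) →
      a ^ 2 * S - 2 * a * (1 - a) * C + N * ((1 - a) ^ 2 * ch.Q₂) + N * (a ^ 2 * ch.No)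
        ≤ N * (D : ℝ) →
      Integrable (dirtyDensity ch c m a σ D) (jointLaw ch N M₁ M₂) ∧
      ∫ p, dirtyDensity ch c m a σ D p ∂(jointLaw ch N M₁ M₂) ≤
        N * (1 / 2 * Real.log (σ / ch.No)) + N * (1 / 2 * Real.log (D / ch.Q₂)) := by
    intro a σ D hσ hD hc1 hc2
    have k1 := fun n => integral_add_enc₂_add_noise_sq ch h₁ h₂ (hf n) (f0 n)
      (((hx n).const_mul 1).add ((hs n).const_mul 1)) 1 n
    -- The estimation error is `-a x₂ + (1 - a) s₂ - a z`, without `x₁`, hence `f = 0`.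
    have k2 := fun n => integral_add_enc₂_add_noise_sq ch (M₁ := M₁) h₁ h₂ (f := 0) MemLp.zero
      (by simp) (((hx n).const_mul (-a)).add ((hs n).const_mul (1 - a))) (-a) n
    simp only [Pi.add_apply] at k1 k2
    have e1 : ∀ n (p : Sample N M₁ M₂), p.2.2 n +
        (c.enc₁ p.1.1 p.1.2 - m + c.enc₂ p.2.1.1 p.2.1.2 + p.2.1.2) n =
        c.enc₁ p.1.1 p.1.2 n - m n + (1 * c.enc₂ p.2.1.1 p.2.1.2 n + 1 * p.2.1.2 n)
          + 1 * p.2.2 n := by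
      intro n p
      simp only [Pi.add_apply, Pi.sub_apply]
      ring
    have e2 : ∀ n (p : Sample N M₁ M₂), p.2.1.2 n +
        (-a • (c.enc₂ p.2.1.1 p.2.1.2 + p.2.1.2 + p.2.2)) n =
        (0 : Fin M₁ × (Fin N → ℝ) → ℝ) p.1 +
          (-a * c.enc₂ p.2.1.1 p.2.1.2 n + (1 - a) * p.2.1.2 n) + -a * p.2.2 n := by
      intro n p
      simp only [Pi.add_apply, Pi.smul_apply, smul_eq_mul, Pi.zero_apply]
      ring
    have b1 := integral_llr_le (P := jointLaw ch N M₁ M₂) (N := N) (Z := fun p => p.2.2)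
      (T := fun p => c.enc₁ p.1.1 p.1.2 - m + c.enc₂ p.2.1.1 p.2.1.2 + p.2.1.2)
      (NNReal.coe_pos.2 ch.No_pos) (NNReal.coe_pos.2 hσ)
      (fun n => (noise_jointLaw ch h₁ h₂ n).1) (fun n => by simp_rw [e1]; exact (k1 n).1)
      (fun n => (noise_jointLaw ch h₁ h₂ n).2) (by
        simp_rw [e1, fun n => (k1 n).2]
        rw [Finset.sum_add_distrib, Finset.sum_add_distrib, comb]
        simp only [Finset.sum_const, Finset.card_univ, Fintype.card_fin, nsmul_eq_mul]
        linarith)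
    have l2 : ∀ n, MemLp (fun p : Sample N M₁ M₂ => p.2.1.2 n) 2 (jointLaw ch N M₁ M₂) ∧
        ∫ p, p.2.1.2 n ^ 2 ∂(jointLaw ch N M₁ M₂) = ch.Q₂ := by
      intro n
      have h := integral_add_enc₂_add_noise_sq ch (M₁ := M₁) h₁ h₂ (f := 0) MemLp.zero (by simp)
        (hs n) 0 n
      simpa [hs2] using h
    have b2 := integral_llr_le (P := jointLaw ch N M₁ M₂) (N := N) (Z := fun p => p.2.1.2)
      (T := fun p => -a • (c.enc₂ p.2.1.1 p.2.1.2 + p.2.1.2 + p.2.2))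
      (NNReal.coe_pos.2 hQ) (NNReal.coe_pos.2 hD)
      (fun n => (l2 n).1) (fun n => by simp_rw [e2]; exact (k2 n).1)
      (fun n => (l2 n).2) (by
        simp_rw [e2, fun n => (k2 n).2]
        rw [Finset.sum_add_distrib, Finset.sum_add_distrib, comb]
        simp only [Finset.sum_const, Finset.card_univ, Fintype.card_fin, nsmul_eq_mul,
          Pi.zero_apply, ne_eq, OfNat.ofNat_ne_zero, not_false_eq_true, zero_pow, integral_zero]
        linarith)
    refine ⟨b1.1.add b2.1, ?_⟩
    unfold dirtyDensity
    rw [integral_add b1.1 b2.1]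
    exact add_le_add b1.2 b2.2
  have hNo : (0 : ℝ) < ch.No := ch.No_pos
  have hQ' : (0 : ℝ) < ch.Q₂ := hQ
  have hP₁' : (0 : ℝ) ≤ ch.P₁ := ch.P₁.coe_nonneg
  have hP₂' : (0 : ℝ) ≤ ch.P₂ := ch.P₂.coe_nonneg
  have hN' : (0 : ℝ) < N := by exact_mod_cast Nat.pos_of_ne_zero hN
  rcases le_total C 0 with hC0 | hC0
  · have hσ : 0 < ch.P₁ + ch.P₂ + ch.Q₂ + ch.No := add_pos_of_nonneg_of_pos zero_le ch.No_pos
    have hD : 0 < ch.P₂ + ch.No := add_pos_of_nonneg_of_pos zero_le ch.No_pos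
    -- With `a = 1` the estimation error is `-(x₂ + z)`, free of `C`, while `C ≤ 0` only lowers the
    -- output power.
    obtain ⟨hi, hle⟩ := main 1 _ _ hσ hD (by push_cast; linarith) (by push_cast; linarith)
    refine ⟨1, _, _, hσ, hD, hi, hle.trans (le_of_eq ?_)⟩
    push_cast
    rw [Real.log_div (by positivity) hNo.ne', Real.log_div (by positivity) hQ'.ne',
      Real.log_div (by positivity) hNo.ne', Real.log_div (by positivity) hQ'.ne']
    ring
  · have hCN : 0 ≤ C / N := by positivity
    -- `V` bounds the mean power of `x₂ + s₂ + z`. The coefficient `a = Q₂ / V` leaves the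
    -- correlation out of the numerator of the linear MMSE coefficient; its error is still at most
    -- `Q₂ (P₂ + No) / V`, and this `1 / V` offsets the growth of `σ = P₁ + V`.
    obtain ⟨V, hV⟩ : ∃ V : ℝ, V = ch.Q₂ + ch.P₂ + ch.No + 2 * (C / N) := ⟨_, rfl⟩
    have hV0 : 0 < V := by rw [hV]; positivity
    have hσ : 0 < ch.P₁ + V := by positivity
    have hD : 0 < ch.Q₂ * (ch.P₂ + ch.No) / V := by positivity
    obtain ⟨σ, hσe⟩ : ∃ σ : ℝ≥0, (σ : ℝ) = ch.P₁ + V := ⟨_, Real.coe_toNNReal _ hσ.le⟩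
    obtain ⟨D, hDe⟩ : ∃ D : ℝ≥0, (D : ℝ) = ch.Q₂ * (ch.P₂ + ch.No) / V :=
      ⟨_, Real.coe_toNNReal _ hD.le⟩
    have hσ' : 0 < σ := NNReal.coe_pos.1 (hσe ▸ hσ)
    have hD' : 0 < D := NNReal.coe_pos.1 (hDe ▸ hD)
    have hCV : 2 * C = N * (V - (ch.Q₂ + ch.P₂ + ch.No)) := by rw [hV]; field_simp; ring
    obtain ⟨hi, hle⟩ := main (ch.Q₂ / V) σ D hσ' hD'
      (by rw [hσe]; linarith) (by
        rw [hDe]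
        calc _ ≤ (ch.Q₂ / V) ^ 2 * (N * ch.P₂) - (ch.Q₂ / V) * (1 - ch.Q₂ / V) * (2 * C) +
              N * ((1 - ch.Q₂ / V) ^ 2 * ch.Q₂) + N * ((ch.Q₂ / V) ^ 2 * ch.No) := by
              have := mul_le_mul_of_nonneg_left hxP (sq_nonneg ((ch.Q₂ : ℝ) / V))
              linarith
          _ = _ := by
              rw [hCV]
              field_simp
              ring)
    refine ⟨_, _, _, hσ', hD', hi, hle.trans ?_⟩
    rw [← mul_add, ← mul_add, ← mul_add, hσe, hDe,
      ← Real.log_mul (by positivity) (by positivity), ← Real.log_mul (by positivity) (by positivity)]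
    refine mul_le_mul_of_nonneg_left (mul_le_mul_of_nonneg_left
      (Real.log_le_log (by positivity) ?_) (by norm_num)) hN'.le
    have hVQ : (ch.Q₂ : ℝ) ≤ V := by rw [hV]; linarith
    -- As `C ≥ 0` gives `V ≥ Q₂`, one has `1 + P₁ / V ≤ 1 + P₁ / Q₂`; the terms `P₂` and `No` on the
    -- right are slack.
    have : (ch.P₁ + V) / V ≤ (ch.P₁ + ch.P₂ + ch.Q₂ + ch.No) / ch.Q₂ := by
      rw [div_le_div_iff₀ hV0 hQ']
      nlinarith [mul_le_mul_of_nonneg_left hVQ hP₁', mul_nonneg hP₂' hV0.le, mul_pos hNo hV0]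
    calc _ = (ch.P₁ + V) / V * ((ch.P₂ + ch.No) / ch.No) := by field_simp
      _ ≤ _ := by gcongr

end

/-! ### From block bounds to rates. -/

/-- A bound on the number of messages that holds for all long codes bounds the rate. -/
theorem rate_mul_log_two_le {R k K : ℝ}
    (h : ∀ ε : ℝ, 0 < ε → ε < 1 → ∀ᶠ N : ℕ in atTop,
      ∃ M : ℝ, (2 : ℝ) ^ ((N : ℝ) * (R - k * ε)) ≤ M ∧
        (1 - ε) * Real.log M ≤ N * K + Real.log 2) :
    R * Real.log 2 ≤ K := by
  -- First `N → ∞` at fixed `ε` removes `log 2 / N`; afterwards `ε → 0`. The factor `k` counts the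
  -- rates that each lose `ε`.
  have h1 : ∀ ε : ℝ, 0 < ε → ε < 1 → (1 - ε) * ((R - k * ε) * Real.log 2) ≤ K := by
    intro ε h0 hlt
    have hlim : Tendsto (fun N : ℕ => K + Real.log 2 / N) atTop (nhds (K + 0)) :=
      tendsto_const_nhds.add (tendsto_const_div_atTop_nhds_zero_nat _)
    rw [add_zero] at hlim
    refine ge_of_tendsto hlim ?_
    filter_upwards [h ε h0 hlt, eventually_gt_atTop 0] with N hN hpos
    obtain ⟨M, hN⟩ := hN
    have hN' : (0 : ℝ) < N := by exact_mod_cast hpos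
    have hlog := Real.log_le_log (by positivity) hN.1
    rw [Real.log_rpow two_pos] at hlog
    have := (mul_le_mul_of_nonneg_left hlog (sub_nonneg.2 hlt.le)).trans hN.2
    rw [← mul_le_mul_iff_of_pos_left hN', mul_add, mul_div_cancel₀ _ hN'.ne']
    linarith
  have hcont : Tendsto (fun ε : ℝ => (1 - ε) * ((R - k * ε) * Real.log 2))
      (nhdsWithin 0 (Set.Ioi 0)) (nhds ((1 - 0) * ((R - k * 0) * Real.log 2))) :=
    (Continuous.tendsto (by fun_prop) 0).mono_left nhdsWithin_le_nhds
  have := le_of_tendsto hcont (by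
    filter_upwards [Ioo_mem_nhdsGT (zero_lt_one (α := ℝ))] with ε hε using h1 ε hε.1 hε.2)
  simpa using this

theorem card_ne_zero_of_rpow_le {x : ℝ} {M : ℕ} (h : (2 : ℝ) ^ x ≤ M) : M ≠ 0 := by
  rintro rfl
  have := Real.rpow_pos_of_pos two_pos x
  simp at h
  linarith

/-- A single-block bound on the number of pairs of messages bounds the sum rate. -/
theorem sum_rate_le {ch : DirtyMAC} {R₁ R₂ : ℝ} (h : ch.Achievable R₁ R₂) {K : ℝ}
    (hK : ∀ (N M₁ M₂ : ℕ) (c : Code N M₁ M₂) (ε : ℝ), N ≠ 0 → M₁ ≠ 0 → M₂ ≠ 0 → 0 ≤ ε →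
      encPower ch.Q₁ c.enc₁ ≤ (ch.P₁ : ℝ≥0∞) → encPower ch.Q₂ c.enc₂ ≤ (ch.P₂ : ℝ≥0∞) →
      ch.errorProb c ≤ ENNReal.ofReal ε →
      (1 - ε) * Real.log (M₁ * M₂) ≤ N * K + Real.log 2) :
    (R₁ + R₂) * Real.log 2 ≤ K := by
  refine rate_mul_log_two_le (k := 2) fun ε h0 _ => ?_
  filter_upwards [h ε h0, eventually_ne_atTop 0] with N hN hN0
  obtain ⟨M₁, M₂, c, hM₁, hM₂, hP₁, hP₂, herr⟩ := hN
  refine ⟨M₁ * M₂, ?_, hK N M₁ M₂ c ε hN0 (card_ne_zero_of_rpow_le hM₁)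
    (card_ne_zero_of_rpow_le hM₂) h0.le hP₁ hP₂ herr⟩
  calc (2 : ℝ) ^ ((N : ℝ) * (R₁ + R₂ - 2 * ε))
      = 2 ^ ((N : ℝ) * (R₁ - ε)) * 2 ^ ((N : ℝ) * (R₂ - ε)) := by
        rw [← Real.rpow_add two_pos]; ring_nf
    _ ≤ M₁ * M₂ := mul_le_mul hM₁ hM₂ (by positivity) (by positivity)

/-- A single-block bound on the number of messages of user `2` bounds its rate. -/
theorem snd_rate_le {ch : DirtyMAC} {R₁ R₂ : ℝ} (h : ch.Achievable R₁ R₂) {K : ℝ}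
    (hK : ∀ (N M₁ M₂ : ℕ) (c : Code N M₁ M₂) (ε : ℝ), N ≠ 0 → M₁ ≠ 0 → M₂ ≠ 0 → 0 ≤ ε →
      encPower ch.Q₂ c.enc₂ ≤ (ch.P₂ : ℝ≥0∞) → ch.errorProb c ≤ ENNReal.ofReal ε →
      (1 - ε) * Real.log M₂ ≤ N * K + Real.log 2) :
    R₂ * Real.log 2 ≤ K := by
  refine rate_mul_log_two_le (k := 1) fun ε h0 _ => ?_
  filter_upwards [h ε h0, eventually_ne_atTop 0] with N hN hN0
  obtain ⟨M₁, M₂, c, hM₁, hM₂, -, hP₂, herr⟩ := hN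
  exact ⟨M₂, by rwa [one_mul], hK N M₁ M₂ c ε hN0 (card_ne_zero_of_rpow_le hM₁)
    (card_ne_zero_of_rpow_le hM₂) h0.le hP₂ herr⟩

theorem sum_rate_le_clean {ch : DirtyMAC} {R₁ R₂ : ℝ} (h : ch.Achievable R₁ R₂) :
    (R₁ + R₂) * Real.log 2 ≤
      1 / 2 * Real.log ((ch.P₁ + ch.P₂ + ch.No) / ch.No) := by
  refine sum_rate_le h fun N M₁ M₂ c ε hN h₁ h₂ hε hP₁ hP₂ herr => ?_
  obtain ⟨m, hf, f0, hfP⟩ := memLp_enc_sub_mean ch c h₁ hN hP₁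
  have hσ : 0 < ch.P₁ + ch.P₂ + ch.No := add_pos_of_nonneg_of_pos zero_le ch.No_pos
  obtain ⟨hi, hle⟩ := integral_cleanDensity_le ch c h₁ h₂ hN hP₂ (κ := fun _ _ => m) hf f0 hfP rfl
  have := log_mul_le (measurable_cleanDensity ch c (fun _ => measurable_const) _) hi h₁ h₂ hε herr
    (by fun_prop) (isReference_cleanDensity ch c h₁ h₂ (fun _ => measurable_const) hσ)
  push_cast at hle
  linarith

theorem snd_rate_le_clean {ch : DirtyMAC} {R₁ R₂ : ℝ} (h : ch.Achievable R₁ R₂) :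
    R₂ * Real.log 2 ≤ 1 / 2 * Real.log ((ch.P₂ + ch.No) / ch.No) := by
  refine snd_rate_le h fun N M₁ M₂ c ε hN h₁ h₂ hε hP₂ herr => ?_
  have hσ : 0 < ch.P₂ + ch.No := add_pos_of_nonneg_of_pos zero_le ch.No_pos
  -- Centring at `x₁` itself leaves a zero residual, hence `P = 0`.
  obtain ⟨hi, hle⟩ := integral_cleanDensity_le ch c h₁ h₂ hN hP₂ (κ := c.enc₁) (P := 0)
    (σ := ch.P₂ + ch.No) (fun n => by simp) (fun n => by simp) (by simp) (by rw [zero_add])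
  have := log_snd_le (measurable_cleanDensity ch c c.measurable_enc₁ _) hi h₁ h₂ hε herr
    (fun w₁ => by have := c.measurable_enc₁ w₁; fun_prop)
    (isReference_cleanDensity ch c h₁ h₂ c.measurable_enc₁ hσ)
  push_cast at hle
  linarith

theorem sum_rate_le_dirty {ch : DirtyMAC} {R₁ R₂ : ℝ} (h : ch.Achievable R₁ R₂)
    (hQ : 0 < ch.Q₂) :
    (R₁ + R₂) * Real.log 2 ≤ 1 / 2 * Real.log ((ch.P₁ + ch.P₂ + ch.Q₂ + ch.No) / ch.Q₂) +
      1 / 2 * Real.log ((ch.P₂ + ch.No) / ch.No) := by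
  refine sum_rate_le h fun N M₁ M₂ c ε hN h₁ h₂ hε hP₁ hP₂ herr => ?_
  obtain ⟨m, hf, f0, hfP⟩ := memLp_enc_sub_mean ch c h₁ hN hP₁
  obtain ⟨a, σ, D, hσ, hD, hi, hle⟩ := integral_dirtyDensity_le ch c h₁ h₂ hN hQ hP₂ hf f0 hfP
  have := log_mul_le (measurable_dirtyDensity ch c m a σ D) hi h₁ h₂ hε herr
    (by fun_prop) (isReference_dirtyDensity ch c h₁ h₂ hQ m a hσ hD)
  linarith

theorem awgnCap_mul_log_two {x y : ℝ} (h : 1 + x = y) :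
    awgnCap x * Real.log 2 = 1 / 2 * Real.log y := by
  have := Real.log_pos one_lt_two
  rw [awgnCap, Real.logb, h]
  field_simp

end DirtyMAC

end

open DirtyMAC in
theorem mainTheorem6 (ch : DirtyMAC) (R₁ R₂ : ℝ) (hR₁ : 0 ≤ R₁) (hR₂ : 0 ≤ R₂)
    (h : ch.Achievable R₁ R₂) :
    R₁ + R₂ ≤ awgnCap (ch.SNR₁ + ch.SNR₂) ∧
    (0 < ch.Q₂ →
      R₁ + R₂ ≤ awgnCap ((1 + ch.SNR₁ + ch.SNR₂) / ch.INR₂) + awgnCap ch.SNR₂) ∧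
    R₂ ≤ awgnCap ch.SNR₂ := by
  have hlog := Real.log_pos one_lt_two
  have hNo : (0 : ℝ) < ch.No := ch.No_pos
  have e₂ : 1 + ch.SNR₂ = (ch.P₂ + ch.No) / ch.No := by
    rw [SNR₂]; field_simp; ring
  refine ⟨?_, fun hQ => ?_, ?_⟩
  · refine le_of_mul_le_mul_right ((sum_rate_le_clean h).trans_eq
      (awgnCap_mul_log_two ?_).symm) hlog
    rw [SNR₁, SNR₂]; field_simp; ring
  · have hQ' : (0 : ℝ) < ch.Q₂ := hQ
    refine le_of_mul_le_mul_right ((sum_rate_le_dirty h hQ).trans_eq ?_) hlog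
    rw [add_mul, awgnCap_mul_log_two e₂, awgnCap_mul_log_two]
    rw [SNR₁, SNR₂, INR₂]; field_simp; ring
  · exact le_of_mul_le_mul_right ((snd_rate_le_clean h).trans_eq
      (awgnCap_mul_log_two e₂).symm) hlog
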